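/- **Setting.** A $C^*$-probability space $(\mathcal A,\varphi)$ is a unital $C^*$-algebra $\mathcal A$ with a state $\varphi$. More generally, a non-commutative probability space $(\mathcal B,\phi)$ is a unital complex algebra with a unital linear functional; its free cumulants are $\kappa_n(x_1,\dots,x_n)=\sum_{\pi\in NC(n)}\phi_\pi(x_1,\dots,x_n)\,\mu_n(\pi,1_n)$, where $NC(n)$ is the lattice of non-crossing partitions of $\{1,\dots,n\}$ with Möbius function $\mu_n$ and largest element $1_n$, and $\phi_\pi$ is the product over the blocks $\{i_1<\dots<i_s\}$ of $\pi$ of $\phi(x_{i_1}\cdots x_{i_s})$. The distribution of a family is the collection of its joint moments, and convergence in distribution (possibly with the space varying along the sequence) is convergence of every joint moment. * A sequence $\{b_n\}_{n\ge1}$ has a *multidimensional free infinitely divisible distribution* if for every $k\ge1$ there are, in some $C^*$-probability space, $k$ freely independent and identically distributed sequences $\{a^{(i)}_{j,k}\}_{i\ge1}$, $j=1,\dots,k$, of self-adjoint elements such that $\{\sum_{j=1}^k a^{(i)}_{j,k}\}_{i\ge1}$ has the same distribution as $\{b_i\}_{i\ge1}$. * A family $\{b_i\}_{i\in I}$ in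 a non-commutative probability space has a *multidimensional compound free Poisson distribution* if there are self-adjoint elements $\{a_i\}_{i\in I}$ of a $C^*$-probability space $(\mathcal A,\varphi)$, numbers $\lambda_i>0$ with $\lambda=\sup_i\lambda_i<\infty$, a free ultrafilter $\omega$ on $\mathbb N$ and, for every $N\in\mathbb N$ with $N\ge\lambda$, projections $p_N^{(i)}$ $(i\in I)$ in a $C^*$-probability space $(\mathcal A_N,\varphi_N)$ with $\varphi_N(p_N^{(i)})=\lambda_i/N$, such that for all $n\ge1$ and $i(1),\dots,i(n)\in I$ $$\kappa_n(b_{i(1)},\dots,b_{i(n)})=\varphi(a_{i(1)}\cdots a_{i(n)})\,\lim_{N\to\omega}N\,\varphi_N\bigl(p_N^{(i(1))}\cdots p_N^{(i(n))}\bigr).$$ * A sequence $\{b_n\}_{n\ge1}$ *satisfies Assumption (A)* if for every $n\ge1$ there are, for $j=1,2,\dots$, self-adjoint elements $p^{(j)}_{1,n},\dots,p^{(j)}_{n,n}$ of a $C^*$-probability space with a faithful state (the space may depend on $n$ and $j$) such that, for every $j$, the $n$-tuple $(p^{(j)}_{1,n},\dots,p^{(j)}_{n,n})$ has a multidimensional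 compound free Poisson distribution and, as $j\to\infty$, it converges in distribution to $(b_1,\dots,b_n)$. **Theorem 3.6.** Let $\{b_n\}_{n\ge1}$ be a sequence of self-adjoint elements of a $C^*$-probability space $(\mathcal A,\varphi)$ which has a multidimensional free infinitely divisible distribution and satisfies Assumption (A). Then there are a $C^*$-probability space $(\mathcal B,\phi)$ and self-adjoint elements $p_{m,n}\in\mathcal B$ $(m,n\ge1)$ such that, for every $m$, the sequence $\{p_{m,n}\}_{n\ge1}$ has a multidimensional compound free Poisson distribution, and $\{p_{m,n}\}_{n\ge1}$ converges in distribution to $\{b_n\}_{n\ge1}$ as $m\to\infty$. -/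

import Mathlib

open Filter Topology

universe u v

namespace FreeProb

noncomputable section

section NoncrossingPartitions

/-- A partition of `{0, …, n-1}` is non-crossing if there are no two different blocks `V`, `W`
and numbers `p₁, p₂ ∈ V`, `q₁, q₂ ∈ W` with `p₁ < q₁ < p₂ < q₂`. -/
def IsNoncrossing {n : ℕ} (π : Finpartition (Finset.univ : Finset (Fin n))) : Prop :=
  ∀ V ∈ π.parts, ∀ W ∈ π.parts, V ≠ W →
    ¬ ∃ p₁ ∈ V, ∃ q₁ ∈ W, ∃ p₂ ∈ V, ∃ q₂ ∈ W, p₁ < q₁ ∧ q₁ < p₂ ∧ p₂ < q₂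

/-- The poset `NC(n)` of non-crossing partitions of an `n`-element ordered set, with
`π ≤ σ` if every block of `π` is contained in a block of `σ`. -/
abbrev NC (n : ℕ) : Type :=
  {π : Finpartition (Finset.univ : Finset (Fin n)) // IsNoncrossing π}

instance instFintypeNC (n : ℕ) : Fintype (NC n) := Fintype.ofFinite _

open Classical in
instance instLocallyFiniteOrderNC (n : ℕ) : LocallyFiniteOrder (NC n) :=
  Fintype.toLocallyFiniteOrder

/-- The partition with one block, as an element of `NC(n)`. -/
def oneBlock (n : ℕ) : NC n :=
  ⟨⊤, fun _ hV _ hW hVW => absurd (Finpartition.parts_top_subsingleton _ hV hW) hVW⟩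

open Classical in
/-- The Möbius function of the poset `NC(n)`: the inverse of the zeta function in the
incidence algebra. -/
def moebius (n : ℕ) (π σ : NC n) : ℂ := IncidenceAlgebra.mu ℂ π σ

end NoncrossingPartitions

section Algebraic

variable {A : Type*} [Ring A] [Algebra ℂ A]

/-- `φ_V(a₁, …, aₙ) = φ(a_{i₁} ⋯ a_{iₛ})` for `V = {i₁ < ⋯ < iₛ}`. -/
def blockMoment (φ : A →ₗ[ℂ] ℂ) {n : ℕ} (a : Fin n → A) (V : Finset (Fin n)) : ℂ :=
  φ ((V.sort (· ≤ ·)).map a).prod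

/-- `φ_π(a₁, …, aₙ)`, the product of the `φ_V(a₁, …, aₙ)` over the blocks `V` of `π`. -/
def partitionMoment (φ : A →ₗ[ℂ] ℂ) {n : ℕ} (a : Fin n → A) (π : NC n) : ℂ :=
  ∏ V ∈ π.1.parts, blockMoment φ a V

/-- The free cumulant `κₙ(a₁, …, aₙ) = ∑_{π ∈ NC(n)} φ_π(a₁, …, aₙ) μₙ(π, 1ₙ)`. -/
def freeCumulant (φ : A →ₗ[ℂ] ℂ) {n : ℕ} (a : Fin n → A) : ℂ :=
  ∑ π : NC n, partitionMoment φ a π * moebius n π (oneBlock n)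

/-- The joint distribution of a family: the functional `P ↦ φ(P(a))` on non-commutative
polynomials. -/
def distribution {ι : Type*} (φ : A →ₗ[ℂ] ℂ) (a : ι → A) : FreeAlgebra ℂ ι →ₗ[ℂ] ℂ :=
  φ ∘ₗ (FreeAlgebra.lift ℂ a).toLinearMap

/-- Free independence of a family of unital subalgebras. -/
def FreeSubalgebras {J : Type*} (φ : A →ₗ[ℂ] ℂ) (S : J → Subalgebra ℂ A) : Prop :=
  ∀ (n : ℕ) (l : Fin (n + 1) → J) (x : Fin (n + 1) → A),
    (∀ r, x r ∈ S (l r)) → (∀ r, φ (x r) = 0) →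
    (∀ r : Fin n, l r.castSucc ≠ l r.succ) →
    φ (List.ofFn x).prod = 0

/-- Free independence of a family (indexed by `J`) of families of elements: the unital
subalgebras generated by these families are freely independent. -/
def FreeFamilies {J ι : Type*} (φ : A →ₗ[ℂ] ℂ) (a : J → ι → A) : Prop :=
  FreeSubalgebras φ fun j => Algebra.adjoin ℂ (Set.range (a j))

/-- Convergence in distribution: convergence of all joint moments. The approximating families
may live in different spaces. -/
def ConvergesInDistribution {ι : Type*} {C : ℕ → Type*} [∀ j, Ring (C j)]
    [∀ j, Algebra ℂ (C j)] (ψ : ∀ j, C j →ₗ[ℂ] ℂ) (a : ∀ j, ι → C j)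
    (φ : A →ₗ[ℂ] ℂ) (b : ι → A) : Prop :=
  ∀ w : List ι, Tendsto (fun j => ψ j (w.map (a j)).prod) atTop (𝓝 (φ (w.map b).prod))

end Algebraic

section CStar

variable {A : Type*} [CStarAlgebra A]

open scoped ComplexOrder in
/-- A state on a unital C⋆-algebra: a unital positive linear functional. A C⋆-probability space
is a unital C⋆-algebra together with a state. -/
def IsState (φ : A →ₗ[ℂ] ℂ) : Prop :=
  φ 1 = 1 ∧ ∀ x : A, 0 ≤ φ (star x * x)

/-- Faithfulness of a state. -/
def IsFaithful (φ : A →ₗ[ℂ] ℂ) : Prop :=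
  ∀ x : A, φ (star x * x) = 0 → x = 0

end CStar

section Classes

variable {B : Type u} [Ring B] [Algebra ℂ B] {ι : Type*}

/-- Multidimensional free infinite divisibility of the distribution of `b`: for every `k ≥ 1`
there are `k` freely independent, identically distributed families of self-adjoint elements of a
C⋆-probability space whose sum has the distribution of `b`. -/
def IsFreelyInfinitelyDivisible (φ : B →ₗ[ℂ] ℂ) (b : ι → B) : Prop :=
  ∀ k : ℕ, 1 ≤ k →
    ∃ (C : Type v) (_ : CStarAlgebra C) (ψ : C →ₗ[ℂ] ℂ) (a : Fin k → ι → C),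
      IsState ψ ∧
      (∀ r i, IsSelfAdjoint (a r i)) ∧
      FreeFamilies ψ a ∧
      (∀ r s, distribution ψ (a r) = distribution ψ (a s)) ∧
      distribution ψ (fun i => ∑ r, a r i) = distribution φ b

/-- The family `b` has a multidimensional compound free Poisson distribution: there are a
C⋆-probability space `(A, φ)` with self-adjoint elements `a i`, numbers `lam i > 0` with
`sup lam i < ∞`, a free ultrafilter `ω` on `ℕ` and, for each natural number `N ≥ sup lam i`,
projections `p N i` in a C⋆-probability space `(D N, ψ N)` with `ψ N (p N i) = lam i / N`, such
that for all `n ≥ 1` and all indices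
`κₙ(b_{i(1)}, …, b_{i(n)}) = φ(a_{i(1)} ⋯ a_{i(n)}) lim_{N → ω} N ψ_N(p_{i(1)} ⋯ p_{i(n)})`.
(What happens at the finitely many `N < sup lam i` is irrelevant, as `ω` is free.) -/
def IsCompoundFreePoisson (φB : B →ₗ[ℂ] ℂ) (b : ι → B) : Prop :=
  ∃ (A : Type v) (_ : CStarAlgebra A) (φ : A →ₗ[ℂ] ℂ) (a : ι → A) (lam : ι → ℝ)
    (ω : Ultrafilter ℕ)
    (D : ℕ → Type v) (_ : ∀ N, CStarAlgebra (D N)) (ψ : ∀ N, D N →ₗ[ℂ] ℂ)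
    (p : ∀ N, ι → D N),
    IsState φ ∧
    (∀ i, IsSelfAdjoint (a i)) ∧
    (∀ i, 0 < lam i) ∧
    BddAbove (Set.range lam) ∧
    (∀ s : Set ℕ, s.Finite → s ∉ ω) ∧
    (∀ N : ℕ, (⨆ i, lam i) ≤ (N : ℝ) →
      IsState (ψ N) ∧
      ∀ i, IsStarProjection (p N i) ∧ ψ N (p N i) = ((lam i / (N : ℝ) : ℝ) : ℂ)) ∧
    ∀ n : ℕ, 1 ≤ n → ∀ i : Fin n → ι, ∃ L : ℂ,
      Tendsto (fun N : ℕ => (N : ℂ) * ψ N (List.ofFn fun r => p N (i r)).prod)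
        (ω : Filter ℕ) (𝓝 L) ∧
      freeCumulant φB (fun r => b (i r)) = φ (List.ofFn fun r => a (i r)).prod * L

/-- Assumption (A) for a sequence `b`: for every `n ≥ 1` there are, for `j = 0, 1, 2, …`,
`n`-tuples of self-adjoint elements of C⋆-probability spaces with faithful states, each tuple
having a multidimensional compound free Poisson distribution, that converge in distribution to
the tuple of the first `n` terms of `b` as `j → ∞`. -/
def AssumptionA (φ : B →ₗ[ℂ] ℂ) (b : ℕ → B) : Prop :=
  ∀ n : ℕ, 1 ≤ n →
    ∃ (C : ℕ → Type v) (_ : ∀ j, CStarAlgebra (C j)) (ψ : ∀ j, C j →ₗ[ℂ] ℂ)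
      (p : ∀ j, Fin n → C j),
      (∀ j, IsState (ψ j) ∧ IsFaithful (ψ j) ∧ (∀ i, IsSelfAdjoint (p j i)) ∧
        IsCompoundFreePoisson.{v, v} (ψ j) (p j)) ∧
      ConvergesInDistribution ψ p φ (fun i : Fin n => b i)

end Classes

end

end FreeProb

/-! The proof is a diagonal argument. For each m, Assumption (A) gives a compound free Poisson (m +
1)-tuple whose moments of order at most m are 1 / (m + 1)-close to those of `b`; zeros extend it to
a sequence. Any fixed word has its length and letters bounded by m from some m on, so its moments
converge.

The tuples live in different spaces. `exists_common_isState` moves them to a single B(H): it takes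
GNS representations, embeds their spaces in one H so that all cyclic vectors become the same Ω, and
uses the vector state of Ω. Moments are preserved, hence so is the compound free Poisson property,
which is a condition on free cumulants. -/

namespace FreeProb

open scoped ComplexOrder InnerProductSpace

/-! ### Gluing unit vectors of Hilbert spaces. -/

section HilbertSpace

/-- If two vectors of the same norm have a symmetric inner product, then the reflection in the
orthogonal complement of their difference exchanges them. -/
theorem reflection_sub_of_inner_comm {E : Type*} [NormedAddCommGroup E] [InnerProductSpace ℂ E]
    {v w : E} (h : ‖v‖ = ‖w‖) (hvw : ⟪v, w⟫_ℂ = ⟪w, v⟫_ℂ) :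
    (ℂ ∙ (v - w))ᗮ.reflection v = w := by
  set R : E ≃ₗᵢ[ℂ] E := (ℂ ∙ (v - w))ᗮ.reflection
  -- The hypotheses make `v + w` orthogonal to `v - w`. So `R` fixes the sum and negates the
  -- difference; adding the two gives `2 R v = 2 w`.
  have hadd : R (v + w) = v + w := by
    apply Submodule.reflection_mem_subspace_eq_self
    rw [Submodule.mem_orthogonal_singleton_iff_inner_left]
    simp only [inner_add_left, inner_sub_right, inner_self_eq_norm_sq_to_K, h, hvw]
    ring
  have hsub : R (v - w) = w - v := by
    rw [Submodule.reflection_orthogonalComplement_singleton_eq_neg, neg_sub]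
  have htwo : (2 : ℂ) • R v = (2 : ℂ) • w := by
    rw [← map_smul, two_smul, two_smul, show v + v = (v + w) + (v - w) by abel, map_add, hadd,
      hsub]
    abel
  exact smul_right_injective E two_ne_zero htwo

/-- Any sequence of Hilbert spaces with distinguished unit vectors embeds isometrically into one
Hilbert space in such a way that all the distinguished vectors have the same image. -/
theorem exists_linearIsometry_common_vector (G : ℕ → Type v) [∀ m, NormedAddCommGroup (G m)]
    [∀ m, InnerProductSpace ℂ (G m)] [∀ m, CompleteSpace (G m)] (ξ : ∀ m, G m)
    (hξ : ∀ m, ‖ξ m‖ = 1) :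
    ∃ (H : Type v) (_ : NormedAddCommGroup H) (_ : InnerProductSpace ℂ H) (_ : CompleteSpace H)
      (W : ∀ m, G m →ₗᵢ[ℂ] H) (Ω : H), ‖Ω‖ = 1 ∧ ∀ m, W m (ξ m) = Ω := by
  let e (m : ℕ) : G m →ₗᵢ[ℂ] lp G 2 :=
    { lp.lsingle (E := G) (𝕜 := ℂ) 2 m with
      norm_map' := fun x => lp.norm_single (by norm_num) m x }
  have he (m : ℕ) : ‖e m (ξ m)‖ = 1 := by rw [(e m).norm_map, hξ]
  -- Different summands of the ℓ² sum are orthogonal, so both sides vanish for `m ≠ 0`.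
  have hinner (m : ℕ) : ⟪e m (ξ m), e 0 (ξ 0)⟫_ℂ = ⟪e 0 (ξ 0), e m (ξ m)⟫_ℂ := by
    rcases eq_or_ne m 0 with rfl | hm
    · rfl
    · have h : ⟪e m (ξ m), e 0 (ξ 0)⟫_ℂ = 0 := by
        refine (lp.inner_single_left m (ξ m) _).trans ?_
        have : (e 0 (ξ 0) : ∀ i, G i) m = 0 := lp.single_apply_ne 2 0 (ξ 0) hm
        rw [this, inner_zero_right]
      rw [h, inner_eq_zero_symm.1 h]
  exact ⟨lp G 2, inferInstance, inferInstance, inferInstance,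
    fun m => ((ℂ ∙ (e m (ξ m) - e 0 (ξ 0)))ᗮ.reflection).toLinearIsometry.comp (e m),
    e 0 (ξ 0), he 0, fun m => reflection_sub_of_inner_comm ((he m).trans (he 0).symm) (hinner m)⟩

end HilbertSpace

/-! ### Realization in a common C⋆-probability space. -/

section States

/-- The GNS representation of a C⋆-probability space: the state is a vector state in it. -/
theorem IsState.exists_gns {C : Type v} [CStarAlgebra C] {φ : C →ₗ[ℂ] ℂ} (hφ : IsState φ) :
    ∃ (H : Type v) (_ : NormedAddCommGroup H) (_ : InnerProductSpace ℂ H) (_ : CompleteSpace H)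
      (π : C →⋆ₐ[ℂ] (H →L[ℂ] H)) (ξ : H), ‖ξ‖ = 1 ∧ ∀ x, φ x = ⟪ξ, π x ξ⟫_ℂ := by
  let := CStarAlgebra.spectralOrder C
  have := CStarAlgebra.spectralOrderedRing C
  let f : C →ₚ[ℂ] ℂ := PositiveLinearMap.mk₀ φ fun x hx => by
    obtain ⟨y, rfl⟩ := CStarAlgebra.nonneg_iff_eq_star_mul_self.1 hx
    exact hφ.2 y
  have hf (x : C) : f x = φ x := rfl
  have hvec (x : C) :
      φ x = ⟪((f.toPreGNS 1 : f.PreGNS) : f.GNS), f.gnsStarAlgHom x (f.toPreGNS 1)⟫_ℂ := by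
    simp [PositiveLinearMap.preGNS_inner_def, hf]
  refine ⟨f.GNS, inferInstance, inferInstance, inferInstance, f.gnsStarAlgHom, f.toPreGNS 1, ?_,
    hvec⟩
  have h := hvec 1
  rw [hφ.1, map_one f.gnsStarAlgHom, one_apply_eq_self] at h
  have h' : ‖((f.toPreGNS 1 : f.PreGNS) : f.GNS)‖ ^ 2 = 1 := by
    rw [← inner_self_eq_norm_sq (𝕜 := ℂ), ← h, RCLike.one_re]
  exact (pow_eq_one_iff_of_nonneg (norm_nonneg _) two_ne_zero).1 h'

/-- The vector state of a vector of a Hilbert space. -/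
noncomputable def vectorState {H : Type*} [NormedAddCommGroup H] [InnerProductSpace ℂ H] (Ω : H) :
    (H →L[ℂ] H) →ₗ[ℂ] ℂ where
  toFun T := ⟪Ω, T Ω⟫_ℂ
  map_add' S T := by simp
  map_smul' c T := by simp

theorem isState_vectorState {H : Type*} [NormedAddCommGroup H] [InnerProductSpace ℂ H]
    [CompleteSpace H] {Ω : H} (hΩ : ‖Ω‖ = 1) : IsState (vectorState Ω) := by
  refine ⟨?_, fun T => ?_⟩
  · simp [vectorState, inner_self_eq_norm_sq_to_K, hΩ]
  · change 0 ≤ ⟪Ω, (star T * T) Ω⟫_ℂ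
    rw [ContinuousLinearMap.mul_def, ContinuousLinearMap.comp_apply, ContinuousLinearMap.star_eq_adjoint,
      ContinuousLinearMap.adjoint_inner_right]
    exact RCLike.nonneg_iff.2 ⟨inner_self_nonneg, inner_self_im _⟩

/-- A sequence of C⋆-probability spaces can be realized in a single one by (possibly non-unital)
⋆-preserving maps which respect all joint moments. -/
theorem exists_common_isState (C : ℕ → Type v) [∀ m, CStarAlgebra (C m)]
    (φ : ∀ m, C m →ₗ[ℂ] ℂ) (hφ : ∀ m, IsState (φ m)) :
    ∃ (B : Type v) (_ : CStarAlgebra B) (ψ : B →ₗ[ℂ] ℂ) (ρ : ∀ m, C m →⋆ₙₐ[ℂ] B), IsState ψ ∧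
      ∀ m (l : List (C m)), ψ (l.map (ρ m)).prod = φ m l.prod := by
  choose G i₁ i₂ i₃ π ξ hξ hπ using fun m => (hφ m).exists_gns
  obtain ⟨H, j₁, j₂, j₃, W, Ω, hΩ, hW⟩ := exists_linearIsometry_common_vector G ξ hξ
  let V (m : ℕ) : G m →L[ℂ] H := (W m).toContinuousLinearMap
  have hVV (m : ℕ) : ContinuousLinearMap.adjoint (V m) ∘L V m = 1 :=
    ContinuousLinearMap.ext fun x => ext_inner_left ℂ fun y => by
      simp [V]
  have hVV' (m : ℕ) (x : G m) : ContinuousLinearMap.adjoint (V m) (V m x) = x :=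
    congrArg (fun T : G m →L[ℂ] G m => T x) (hVV m)
  -- `x ↦ V π(x) V*` is multiplicative since `V* V = 1`; it sends `1` to the projection `V V*`,
  -- hence need not be unital.
  let ρ (m : ℕ) : C m →⋆ₙₐ[ℂ] (H →L[ℂ] H) :=
    { toFun := fun x => V m ∘L π m x ∘L ContinuousLinearMap.adjoint (V m)
      map_smul' := fun c x => by ext; simp
      map_zero' := by ext; simp
      map_add' := fun x y => by ext; simp
      map_mul' := fun x y => by ext; simp [hVV']
      map_star' := fun x => by
        simp [ContinuousLinearMap.star_eq_adjoint, ContinuousLinearMap.adjoint_comp, map_star,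
          ContinuousLinearMap.comp_assoc] }
  -- Non-unitality does no harm to the empty product, because `Ω = V ξ` lies in the range of `V`.
  have hρ (m : ℕ) (l : List (C m)) : (l.map (ρ m)).prod Ω = V m (π m l.prod (ξ m)) := by
    induction l with
    | nil => simpa [V] using (hW m).symm
    | cons x l ih =>
      rw [List.map_cons, List.prod_cons, ContinuousLinearMap.mul_def,
        ContinuousLinearMap.comp_apply, ih]
      simp [ρ, hVV']
  refine ⟨H →L[ℂ] H, inferInstance, vectorState Ω, ρ, isState_vectorState hΩ, fun m l => ?_⟩
  change ⟪Ω, (l.map (ρ m)).prod Ω⟫_ℂ = _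
  rw [hρ, hπ, ← hW m]
  exact (W m).inner_map_map _ _

end States

/-! ### Dependence on joint moments only. -/

section Cumulants

variable {A B : Type*} [Ring A] [Algebra ℂ A] [Ring B] [Algebra ℂ B]

theorem blockMoment_congr {φ : A →ₗ[ℂ] ℂ} {ψ : B →ₗ[ℂ] ℂ} {n : ℕ} {a : Fin n → A} {b : Fin n → B}
    (h : ∀ l : List (Fin n), φ (l.map a).prod = ψ (l.map b).prod) (V : Finset (Fin n)) :
    blockMoment φ a V = blockMoment ψ b V :=
  h _

/-- Free cumulants only depend on the joint moments. -/
theorem freeCumulant_congr {φ : A →ₗ[ℂ] ℂ} {ψ : B →ₗ[ℂ] ℂ} {n : ℕ} {a : Fin n → A}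
    {b : Fin n → B} (h : ∀ l : List (Fin n), φ (l.map a).prod = ψ (l.map b).prod) :
    freeCumulant φ a = freeCumulant ψ b := by
  simp only [freeCumulant, partitionMoment, blockMoment_congr h]

/-- A free cumulant vanishes if one of its arguments does. -/
theorem freeCumulant_eq_zero (φ : A →ₗ[ℂ] ℂ) {n : ℕ} {a : Fin n → A} {r : Fin n} (h : a r = 0) :
    freeCumulant φ a = 0 := by
  refine Finset.sum_eq_zero fun π _ => mul_eq_zero_of_left ?_ _
  obtain ⟨V, hV, hr⟩ := π.1.exists_mem (Finset.mem_univ r)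
  refine Finset.prod_eq_zero hV ?_
  rw [blockMoment, List.prod_eq_zero, map_zero]
  exact List.mem_map.2 ⟨r, (Finset.mem_sort _).2 hr, h⟩

/-- Being compound free Poisson only depends on the joint moments. -/
theorem IsCompoundFreePoisson.congr {A B : Type u} [Ring A] [Algebra ℂ A] [Ring B] [Algebra ℂ B]
    {ι : Type*} {φ : A →ₗ[ℂ] ℂ} {ψ : B →ₗ[ℂ] ℂ} {a : ι → A} {b : ι → B}
    (h : ∀ l : List ι, φ (l.map a).prod = ψ (l.map b).prod)
    (ha : IsCompoundFreePoisson.{u, v} φ a) : IsCompoundFreePoisson.{u, v} ψ b := by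
  obtain ⟨C, i₁, χ, c, lam, ω, D, i₂, η, p, h₁, h₂, h₃, h₄, h₅, h₆, h₇⟩ := ha
  refine ⟨C, i₁, χ, c, lam, ω, D, i₂, η, p, h₁, h₂, h₃, h₄, h₅, h₆, fun n hn i => ?_⟩
  obtain ⟨L, hL, hκ⟩ := h₇ n hn i
  refine ⟨L, hL, (freeCumulant_congr fun l => ?_).trans hκ⟩
  simpa [List.map_map, Function.comp_def] using (h (l.map i)).symm

end Cumulants

/-! ### From tuples to sequences. -/

section Padding

/-- Extend a tuple to a sequence by zeros. -/
def padZero {B : Type*} [Zero B] {n : ℕ} (b : Fin n → B) (k : ℕ) : B :=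
  if h : k < n then b ⟨k, h⟩ else 0

theorem padZero_of_lt {B : Type*} [Zero B] {n : ℕ} (b : Fin n → B) {k : ℕ} (h : k < n) :
    padZero b k = b ⟨k, h⟩ :=
  dif_pos h

theorem padZero_of_le {B : Type*} [Zero B] {n : ℕ} (b : Fin n → B) {k : ℕ} (h : n ≤ k) :
    padZero b k = 0 :=
  dif_neg h.not_gt

theorem isSelfAdjoint_padZero {B : Type*} [NonUnitalRing B] [StarRing B] {n : ℕ} {b : Fin n → B}
    (h : ∀ i, IsSelfAdjoint (b i)) (k : ℕ) : IsSelfAdjoint (padZero b k) := by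
  rcases lt_or_ge k n with hk | hk
  · rw [padZero_of_lt b hk]
    exact h _
  · rw [padZero_of_le b hk]
    exact IsSelfAdjoint.zero _

/-- A compound free Poisson tuple, extended by zeros, is compound free Poisson: extend the
elements `a i` by zeros and repeat the projections. -/
theorem IsCompoundFreePoisson.padZero {B : Type u} [Ring B] [Algebra ℂ B] {φ : B →ₗ[ℂ] ℂ} {m : ℕ}
    {b : Fin (m + 1) → B} (hb : IsCompoundFreePoisson.{u, v} φ b) :
    IsCompoundFreePoisson.{u, v} φ (padZero b) := by
  obtain ⟨C, i₁, χ, c, lam, ω, D, i₂, η, p, h₁, h₂, h₃, h₄, h₅, h₆, h₇⟩ := hb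
  -- Reduction mod `m + 1`. The weights must stay positive, so they and the projections are repeated
  -- rather than padded by zeros; surjectivity of `f` keeps the supremum of the weights.
  let f (k : ℕ) : Fin (m + 1) := Fin.ofNat (m + 1) k
  have hf (k : ℕ) (hk : k < m + 1) : f k = ⟨k, hk⟩ := Fin.ext (Nat.mod_eq_of_lt hk)
  have hsurj : Function.Surjective f := fun i => ⟨i, hf i i.2⟩
  refine ⟨C, i₁, χ, FreeProb.padZero c, lam ∘ f, ω, D, i₂, η, fun N => p N ∘ f, h₁,
    isSelfAdjoint_padZero h₂, fun k => h₃ (f k), h₄.mono (Set.range_comp_subset_range f lam), h₅,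
    fun N hN => ?_, fun n hn i => ?_⟩
  · have hsup : ⨆ k, (lam ∘ f) k = ⨆ i, lam i := hsurj.iSup_comp lam
    obtain ⟨hη, hp⟩ := h₆ N (hsup ▸ hN)
    exact ⟨hη, fun k => hp (f k)⟩
  · obtain ⟨L, hL, hκ⟩ := h₇ n hn (f ∘ i)
    refine ⟨L, hL, ?_⟩
    -- An index beyond the tuple puts a zero into both the cumulant and the moment of the `a i`, so
    -- both sides vanish whatever `L` is.
    by_cases hi : ∀ r, i r < m + 1
    · have hib (r : Fin n) : FreeProb.padZero b (i r) = b ((f ∘ i) r) := by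
        rw [padZero_of_lt b (hi r), Function.comp_apply, hf _ (hi r)]
      have hic (r : Fin n) : FreeProb.padZero c (i r) = c ((f ∘ i) r) := by
        rw [padZero_of_lt c (hi r), Function.comp_apply, hf _ (hi r)]
      simp only [hib, hic, hκ]
    · push Not at hi
      obtain ⟨r, hr⟩ := hi
      rw [freeCumulant_eq_zero φ (r := r) (padZero_of_le b hr), List.prod_eq_zero, map_zero,
        zero_mul]
      exact List.mem_ofFn.2 ⟨r, padZero_of_le c hr⟩

end Padding

/-! ### Diagonal approximation. -/

section Convergence

/-- Convergence in distribution of a tuple gives simultaneous approximation of all its moments of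
bounded order. -/
theorem ConvergesInDistribution.exists_forall_length_le {A : Type*} [Ring A] [Algebra ℂ A]
    {ι : Type*} [Finite ι] {C : ℕ → Type*} [∀ j, Ring (C j)] [∀ j, Algebra ℂ (C j)]
    {ψ : ∀ j, C j →ₗ[ℂ] ℂ} {a : ∀ j, ι → C j} {φ : A →ₗ[ℂ] ℂ} {b : ι → A}
    (h : ConvergesInDistribution ψ a φ b) (n : ℕ) {ε : ℝ} (hε : 0 < ε) :
    ∃ j, ∀ w : List ι, w.length ≤ n → dist (ψ j (w.map (a j)).prod) (φ (w.map b).prod) < ε := by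
  -- Finitely many words are involved, so one `j` serves them all.
  have hfin : {w : List ι | w.length ≤ n}.Finite := List.finite_length_le ι n
  have hev : ∀ᶠ j in atTop, ∀ w ∈ {w : List ι | w.length ≤ n},
      dist (ψ j (w.map (a j)).prod) (φ (w.map b).prod) < ε :=
    (Filter.eventually_all_finite hfin).2 fun w _ => Metric.tendsto_nhds.1 (h w) ε hε
  exact hev.exists

/-- For a sequence with Assumption (A), every `m` admits an `(m + 1)`-tuple with a compound free
Poisson distribution whose moments of order at most `m` are `1 / (m + 1)`-close. -/
theorem AssumptionA.exists_approximation {A : Type u} [Ring A] [Algebra ℂ A] {φ : A →ₗ[ℂ] ℂ}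
    {b : ℕ → A} (hA : AssumptionA.{u, v} φ b) (m : ℕ) :
    ∃ (C : Type v) (_ : CStarAlgebra C) (ψ : C →ₗ[ℂ] ℂ) (p : Fin (m + 1) → C),
      IsState ψ ∧ (∀ i, IsSelfAdjoint (p i)) ∧ IsCompoundFreePoisson.{v, v} ψ p ∧
      ∀ w : List (Fin (m + 1)), w.length ≤ m →
        dist (ψ (w.map p).prod) (φ (w.map fun i : Fin (m + 1) => b i).prod) < 1 / ((m : ℝ) + 1) := by
  obtain ⟨C, i, ψ, p, hp, hconv⟩ := hA (m + 1) (Nat.le_add_left 1 m)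
  obtain ⟨j, hj⟩ := hconv.exists_forall_length_le m (Nat.one_div_pos_of_nat (α := ℝ) (n := m))
  exact ⟨C j, i j, ψ j, p j, (hp j).1, (hp j).2.2.1, (hp j).2.2.2, hj⟩

end Convergence

end FreeProb

open FreeProb in
theorem theorem3p6 {A : Type u} [CStarAlgebra A] (φ : A →ₗ[ℂ] ℂ) (hφ : FreeProb.IsState φ)
    (b : ℕ → A) (hb : ∀ n, IsSelfAdjoint (b n))
    (hdiv : FreeProb.IsFreelyInfinitelyDivisible.{u, v} φ b)
    (hA : FreeProb.AssumptionA.{u, v} φ b) :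
    ∃ (B : Type v) (_ : CStarAlgebra B) (ψ : B →ₗ[ℂ] ℂ) (p : ℕ → ℕ → B),
      FreeProb.IsState ψ ∧
      (∀ m n, IsSelfAdjoint (p m n)) ∧
      (∀ m, FreeProb.IsCompoundFreePoisson.{v, v} ψ (p m)) ∧
      FreeProb.ConvergesInDistribution (fun _ : ℕ => ψ) p φ b := by
  choose C i χ q hχ hq hqP hdist using fun m => hA.exists_approximation m
  obtain ⟨B, iB, ψ, ρ, hψ, hρ⟩ := exists_common_isState C χ hχ
  have hmom (m : ℕ) (w : List ℕ) :
      χ m (w.map (padZero (q m))).prod = ψ (w.map fun k => ρ m (padZero (q m) k)).prod := by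
    simpa [List.map_map, Function.comp_def] using (hρ m (w.map (padZero (q m)))).symm
  refine ⟨B, iB, ψ, fun m k => ρ m (padZero (q m) k), hψ,
    fun m k => (isSelfAdjoint_padZero (hq m) k).map (ρ m), fun m => (hqP m).padZero.congr (hmom m),
    fun w => ?_⟩
  rw [tendsto_iff_dist_tendsto_zero]
  refine squeeze_zero' (Eventually.of_forall fun _ => dist_nonneg) ?_
    (tendsto_one_div_add_atTop_nhds_zero_nat (𝕜 := ℝ))
  -- The sum of the word is a convenient upper bound for each of its letters.
  filter_upwards [eventually_ge_atTop w.length, eventually_ge_atTop w.sum] with m hlen hsum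
  have hlt : ∀ k ∈ w, k < m + 1 := fun k hk =>
    Nat.lt_succ_of_le ((List.le_sum_of_mem hk).trans hsum)
  obtain ⟨w', rfl⟩ : ∃ w' : List (Fin (m + 1)), w'.map Fin.val = w :=
    ⟨w.pmap Fin.mk hlt, by simp [List.map_pmap]⟩
  have hpad : (fun k : Fin (m + 1) => padZero (q m) k) = q m :=
    funext fun k => padZero_of_lt (q m) k.2
  have := hdist m w' (by simpa using hlen)
  rw [← hmom, List.map_map, List.map_map, Function.comp_def, hpad]
  exact this.le
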